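/- For a prime $\ell\ge 3$ and an integer $k$ with $1\le k\le \ell-2$, put $$M_{k,\ell}=\{j\in(\mathbb Z/\ell\mathbb Z)^* : \langle kj\rangle_\ell+\langle j\rangle_\ell<\ell\},\qquad W_{k,\ell}=\{w\in(\mathbb Z/\ell\mathbb Z)^* : wM_{k,\ell}=M_{k,\ell}\},$$ where $\langle j\rangle_\ell\in\{1,\dots,\ell-1\}$ denotes the representative of $j$ modulo $\ell$. Let $E_{k,\ell}(a)=0$ if $a\in M_{k,\ell}$ and $E_{k,\ell}(a)=1$ otherwise, and let $$D_{k,\ell}=\left(E_{k,\ell}(-c^{-1}a)-\tfrac12\right)_{c,a\in M_{k,\ell}/W_{k,\ell}}$$ be the Demjanenko matrix. Let $\mathcal K_\ell$ be the set of integers $1\le k\le \ell-2$ for which $D_{k,\ell}$ is singular. For integers $\beta\ge 0$ and $m\ge 1$ with $\gcd(m,6)=1$, let $\mathcal L_{\beta,m}$ be the set of primes of the form $\ell=2^\alpha 3^\beta m+1$ with an integer $\alpha>0$ such that $\mathcal K_\ell\neq\emptyset$. Theorem. For all integers $\beta\ge 0$ and $m\ge 1$ with $\gcd(m,6)=1$,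 the set $\mathcal L_{\beta,m}$ is finite. More precisely, $\mathcal L_{0,m}=\emptyset$, and there is an absolute constant $C$ such that $$\#\mathcal L_{\beta,m}\le C\,\frac{3^{2\beta}m^2}{\beta}$$ for all integers $\beta\ge 1$ and $m\ge 1$ with $\gcd(m,6)=1$. -/

import Mathlib

open scoped Pointwise

namespace Demjanenko

noncomputable section

/-- The set `M_{k,ℓ}` of the `j ∈ (ℤ/ℓℤ)ˣ` with `⟨kj⟩ + ⟨j⟩ < ℓ`, where `⟨x⟩` is the least
non-negative representative of the residue class `x` (it lies in `1, …, ℓ - 1` for `x ≠ 0`). -/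
def M (k ℓ : ℕ) : Set (ZMod ℓ)ˣ :=
  {j | ((k : ZMod ℓ) * (j : ZMod ℓ)).val + (j : ZMod ℓ).val < ℓ}

/-- The group `W_{k,ℓ}` of the `w ∈ (ℤ/ℓℤ)ˣ` with `w M_{k,ℓ} = M_{k,ℓ}`. -/
def W (k ℓ : ℕ) : Subgroup (ZMod ℓ)ˣ :=
  MulAction.stabilizer (ZMod ℓ)ˣ (M k ℓ)

theorem mem_W (k ℓ : ℕ) (w : (ZMod ℓ)ˣ) : w ∈ W k ℓ ↔ w • M k ℓ = M k ℓ :=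
  Iff.rfl

/-- The set `M_{k,ℓ} / W_{k,ℓ}` of classes modulo `W_{k,ℓ}` of elements of `M_{k,ℓ}`. -/
def MmodW (k ℓ : ℕ) : Set ((ZMod ℓ)ˣ ⧸ W k ℓ) :=
  (fun a : (ZMod ℓ)ˣ => (a : (ZMod ℓ)ˣ ⧸ W k ℓ)) '' M k ℓ

open Classical in
/-- The function `E_{k,ℓ}` on `(ℤ/ℓℤ)ˣ`: it is `0` on `M_{k,ℓ}` and `1` off `M_{k,ℓ}`. -/
def E (k ℓ : ℕ) (a : (ZMod ℓ)ˣ) : ℚ :=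
  if a ∈ M k ℓ then 0 else 1

theorem mul_mem_M_iff {k ℓ : ℕ} (a : (ZMod ℓ)ˣ) {w : (ZMod ℓ)ˣ} (hw : w ∈ W k ℓ) :
    a * w ∈ M k ℓ ↔ a ∈ M k ℓ := by
  have h : w • M k ℓ = M k ℓ := hw
  conv_lhs => rw [← h, mul_comm a w, ← smul_eq_mul]
  exact Set.smul_mem_smul_set_iff

/-- `E_{k,ℓ}` as a function on the classes modulo `W_{k,ℓ}`. -/
def EBar (k ℓ : ℕ) (x : (ZMod ℓ)ˣ ⧸ W k ℓ) : ℚ :=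
  Quotient.liftOn' x (E k ℓ) (by
    intro a b hab
    have hw : a⁻¹ * b ∈ W k ℓ := QuotientGroup.leftRel_apply.mp hab
    have h := mul_mem_M_iff a hw
    rw [mul_inv_cancel_left] at h
    by_cases ha : a ∈ M k ℓ
    · rw [E, E, if_pos ha, if_pos (h.mpr ha)]
    · rw [E, E, if_neg ha, if_neg (mt h.mp ha)])

/-- The Demjanenko matrix `D_{k,ℓ} = (E_{k,ℓ}(-c⁻¹a) - 1/2)`, indexed by the classes
`c, a ∈ M_{k,ℓ} / W_{k,ℓ}`. -/
def D (k ℓ : ℕ) : Matrix (MmodW k ℓ) (MmodW k ℓ) ℚ :=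
  Matrix.of fun c a =>
    EBar k ℓ (((-1 : (ZMod ℓ)ˣ) : (ZMod ℓ)ˣ ⧸ W k ℓ) * (c.1⁻¹ * a.1)) - 1 / 2

theorem D_apply_mk (k ℓ : ℕ) (c a : (ZMod ℓ)ˣ) (hc : c ∈ M k ℓ) (ha : a ∈ M k ℓ) :
    D k ℓ ⟨(c : (ZMod ℓ)ˣ ⧸ W k ℓ), c, hc, rfl⟩ ⟨(a : (ZMod ℓ)ˣ ⧸ W k ℓ), a, ha, rfl⟩
      = E k ℓ (-(c⁻¹ * a)) - 1 / 2 := by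
  have h : -(c⁻¹ * a) = -1 * (c⁻¹ * a) := by rw [neg_one_mul]
  rw [h]
  rfl

instance (k ℓ : ℕ) [NeZero ℓ] : Fintype (MmodW k ℓ) := Fintype.ofFinite _

open Classical in
/-- The set `K_ℓ` of the positive integers `k ≤ ℓ - 2` for which `D_{k,ℓ}` is singular. -/
def K (ℓ : ℕ) [NeZero ℓ] : Set ℕ :=
  {k | 1 ≤ k ∧ k + 2 ≤ ℓ ∧ (D k ℓ).det = 0}

/-- The set `L_{β,m}` of the primes `ℓ` of the form `2 ^ α * 3 ^ β * m + 1`, with `α > 0`,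
for which `K_ℓ` is non-empty. -/
def L (β m : ℕ) : Set ℕ :=
  {ℓ | ∃ _ : Fact ℓ.Prime, (∃ α : ℕ, 0 < α ∧ ℓ = 2 ^ α * 3 ^ β * m + 1) ∧ (K ℓ).Nonempty}

end

end Demjanenko

/-!
For odd `χ` the sum `∑ χ(a) (E(a) - 1/2)` is an eigenvalue of convolution with the odd function
`E - 1/2`. A kernel vector of the Demjanenko matrix extends to an odd `W`-invariant function that
this convolution kills, so a singular matrix yields an odd Dirichlet character `χ`, trivial on `W`,
with `∑ χ(a) E(a) = 0` (`exists_odd_character_of_det_eq_zero`). Since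
`ℓ E(a) = ⟨ka⟩ + ⟨a⟩ - ⟨(k + 1)a⟩`, the sum equals `(χ(k)⁻¹ + 1 - χ(k + 1)⁻¹) B_{1,χ} / ℓ`.

The factor `B_{1,χ} = ∑ χ(a) ⟨a⟩` does not vanish (`DirichletCharacter.Odd.sum_mul_val_ne_zero`):
the functional equation and `L(χ⁻¹, 1) ≠ 0` give `L(χ, 0) ≠ 0`, and `L(χ, 0) = -B_{1,χ} / ℓ` follows
from the value `1/2 - x` of the odd Hurwitz zeta function at `s = 0`. That value is obtained by
continuing the series with the terms for `n + x` and `n + 1 - x` paired to `0 < re s`, and letting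
`s → 0` along the reals, where convexity squeezes it between telescoping series.

So `1 + χ(k)⁻¹ = χ(k + 1)⁻¹`, a relation between numbers of absolute value `1`. It forces
`u = χ(k)⁻¹` to be a primitive cube root of unity and `χ(k + 1)⁻¹ = -u²`. In particular
`3 ∣ ℓ - 1`, which settles the case `β = 0`. Write `ℓ = 2 ^ α * N + 1` with `N = 3 ^ β * m` odd. An
odd character is injective on the 2-part of the unit group, hence `k ^ N = 1` and
`(k + 1) ^ N = -1` modulo `ℓ`. Moreover `k² + k + 1 ≠ 0`, because otherwise `k ∈ W`, where `χ` is
trivial (`pow_eq_of_det_eq_zero`). Hence `ℓ` divides the resultant of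
`(X ^ N - 1) / (X² + X + 1)` and `(X + 1) ^ N + 1`, a non-zero integer of absolute value at most
`3 ^ N²` that does not depend on `α` (`exists_int_dvd_of_common_root`). The primes in question are
larger than `3 ^ β`, so there are at most `N² / β` of them.
-/

/-! ### The odd Hurwitz zeta function at `0` -/

section HurwitzZeta

open Complex Filter Topology Set

theorem convexOn_rpow_neg_Ioi {σ : ℝ} (hσ : 0 ≤ σ) :
    ConvexOn ℝ (Ioi (0 : ℝ)) fun t : ℝ => t ^ (-σ) := by
  have h1 : ConvexOn ℝ (Ioi (0 : ℝ)) fun t : ℝ => σ * (-Real.log t) := by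
    have := strictConcaveOn_log_Ioi.concaveOn.neg.smul hσ
    simpa [smul_eq_mul] using this
  have h2 : ConvexOn ℝ (Ioi (0 : ℝ)) (Real.exp ∘ fun t : ℝ => σ * (-Real.log t)) :=
    (convexOn_exp.subset (subset_univ _)
      ((isPreconnected_Ioi.image _ (continuousOn_const.mul
        (Real.continuousOn_log.mono fun t ht => (ne_of_gt ht)).neg)).ordConnected.convex)).comp h1
      (Real.exp_monotone.monotoneOn _)
  exact h2.congr fun t ht => by
    simp [Real.rpow_def_of_pos (show 0 < t from ht)]; ring_nf

theorem norm_cpow_neg_sub_cpow_neg_le {a b c : ℝ} (hc : 0 < c) (ha : c ≤ a) (hb : c ≤ b)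
    {s : ℂ} (hs : 0 ≤ s.re) :
    ‖(a : ℂ) ^ (-s) - (b : ℂ) ^ (-s)‖ ≤ ‖s‖ * c ^ (-s.re - 1) * |a - b| := by
  have key := (convex_Ici c).norm_image_sub_le_of_norm_hasDerivWithin_le
    (f := fun t : ℝ => (t : ℂ) ^ (-s)) (f' := fun t : ℝ => -s * (t : ℂ) ^ (-s - 1))
    (C := ‖s‖ * c ^ (-s.re - 1)) (x := b) (y := a) ?_ ?_ hb ha
  · simpa [Real.norm_eq_abs] using key
  · intro t ht
    have ht0 : 0 < t := hc.trans_le ht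
    have h := ((hasDerivAt_id (t : ℂ)).cpow_const (c := -s)
      (Or.inl (by simpa using ht0))).comp_ofReal
    simpa using h.hasDerivWithinAt
  · intro t ht
    have ht0 : 0 < t := hc.trans_le ht
    rw [norm_mul, norm_neg, norm_cpow_eq_rpow_re_of_pos ht0]
    refine mul_le_mul_of_nonneg_left ?_ (norm_nonneg _)
    simpa using Real.rpow_le_rpow_of_nonpos hc ht (by linarith : -s.re - 1 ≤ 0)

/-- The summand of the series for `2 * hurwitzZetaOdd x s`, at `n`. -/
noncomputable def hurwitzOddTerm (x : ℝ) (n : ℕ) (s : ℂ) : ℂ :=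
  (((n + x : ℝ) : ℂ)) ^ (-s) - (((n + 1 - x : ℝ) : ℂ)) ^ (-s)

/-- On the bounded region `ε ≤ re s`, `‖s‖ ≤ R` the terms are dominated by those of a convergent
series. Both `n + x` and `n + 1 - x` are at least `c * (n + 1)`. -/
theorem norm_hurwitzOddTerm_le {x c : ℝ} (hc : 0 < c) (hcx : c ≤ x) (hcx' : c ≤ 1 - x) (n : ℕ)
    {s : ℂ} {ε R : ℝ} (hε : 0 < ε) (hs : ε ≤ s.re) (hR : ‖s‖ ≤ R) :
    ‖hurwitzOddTerm x n s‖ ≤ R * c ^ (-R - 1) * (1 / |(n : ℝ) + 1| ^ (1 + ε)) := by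
  have hn : (0 : ℝ) ≤ n := n.cast_nonneg
  have hc1 : c ≤ 1 := by linarith
  have hb := norm_cpow_neg_sub_cpow_neg_le (a := n + x) (b := n + 1 - x) (c := c * (n + 1))
    (s := s) (by positivity) (by nlinarith) (by nlinarith) (by linarith)
  have hre : s.re ≤ R := (re_le_norm s).trans hR
  have hR0 : 0 ≤ R := (norm_nonneg s).trans hR
  refine hb.trans ?_
  rw [Real.mul_rpow hc.le (by positivity), abs_of_pos (by positivity : (0 : ℝ) < n + 1), one_div,
    ← Real.rpow_neg (by positivity)]
  have h1 : c ^ (-s.re - 1) ≤ c ^ (-R - 1) :=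
    Real.rpow_le_rpow_of_exponent_ge hc hc1 (by linarith)
  have h2 : ((n : ℝ) + 1) ^ (-s.re - 1) ≤ ((n : ℝ) + 1) ^ (-(1 + ε)) :=
    Real.rpow_le_rpow_of_exponent_le (by linarith) (by linarith)
  have h3 : |(n + x : ℝ) - (n + 1 - x)| ≤ 1 := by
    rw [abs_le]; constructor <;> linarith
  calc ‖s‖ * (c ^ (-s.re - 1) * ((n : ℝ) + 1) ^ (-s.re - 1)) * |(n + x : ℝ) - (n + 1 - x)|
      ≤ R * (c ^ (-R - 1) * ((n : ℝ) + 1) ^ (-(1 + ε))) * 1 := by gcongr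
    _ = _ := by ring

/-- The Dirichlet series of `hurwitzZetaOdd x`, with the terms for `n + x` and `n + 1 - x` paired,
converges in the larger half-plane `0 < re s`. -/
theorem hasSum_hurwitzOddTerm {x : ℝ} (hx : x ∈ Ioo (0 : ℝ) 1) {s : ℂ} (hs : 0 < s.re) :
    HasSum (fun n : ℕ => hurwitzOddTerm x n s) (2 * HurwitzZeta.hurwitzZetaOdd x s) := by
  obtain ⟨c, hc, hcx, hcx'⟩ : ∃ c : ℝ, 0 < c ∧ c ≤ x ∧ c ≤ 1 - x :=
    ⟨min x (1 - x), lt_min hx.1 (by linarith [hx.2]), min_le_left _ _, min_le_right _ _⟩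
  set ε : ℝ := min s.re 1 / 2 with hεdef
  have hε : 0 < ε := by positivity
  have hεs : ε < s.re := by
    have := min_le_left s.re 1
    linarith
  have hε2 : ε < 2 := by
    have := min_le_right s.re 1
    linarith
  set R : ℝ := ‖s‖ + 3
  have hs0 := norm_nonneg s
  let U : Set ℂ := {z | ε < z.re} ∩ Metric.ball 0 R
  have hUo : IsOpen U := (isOpen_lt continuous_const continuous_re).inter Metric.isOpen_ball
  have hUc : IsPreconnected U :=
    ((convex_halfSpace_re_gt ε).inter (convex_ball 0 R)).isPreconnected
  have hsU : s ∈ U := ⟨hεs, by simp [R]⟩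
  have h2U : (2 : ℂ) ∈ U := ⟨by simpa using hε2, by simp [R]; linarith⟩
  have hsum : Summable fun n : ℕ => R * c ^ (-R - 1) * (1 / |(n : ℝ) + 1| ^ (1 + ε)) :=
    ((Real.summable_one_div_nat_add_rpow 1 (1 + ε)).mpr (by linarith)).mul_left _
  have hbound : ∀ (n : ℕ) (w : ℂ), w ∈ U →
      ‖hurwitzOddTerm x n w‖ ≤ R * c ^ (-R - 1) * (1 / |(n : ℝ) + 1| ^ (1 + ε)) := fun n w hw =>
    norm_hurwitzOddTerm_le hc hcx hcx' n hε (le_of_lt hw.1) (le_of_lt (by simpa using hw.2))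
  have hdiff : DifferentiableOn ℂ (fun w => ∑' n : ℕ, hurwitzOddTerm x n w) U := by
    refine differentiableOn_tsum_of_summable_norm hsum (fun n => ?_) hUo hbound
    have hn : (0 : ℝ) ≤ n := n.cast_nonneg
    have h1 : (((n + x : ℝ) : ℂ)) ≠ 0 := ofReal_ne_zero.mpr (by linarith [hx.1])
    have h2 : (((n + 1 - x : ℝ) : ℂ)) ≠ 0 := ofReal_ne_zero.mpr (by linarith [hx.2])
    refine Differentiable.differentiableOn ?_
    unfold hurwitzOddTerm
    exact (differentiable_neg.const_cpow (Or.inl h1)).sub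
      (differentiable_neg.const_cpow (Or.inl h2))
  have heq : EqOn (fun w => ∑' n : ℕ, hurwitzOddTerm x n w)
      (fun w => 2 * HurwitzZeta.hurwitzZetaOdd x w) U := by
    refine (hdiff.analyticOnNhd hUo).eqOn_of_preconnected_of_eventuallyEq
      (((HurwitzZeta.differentiable_hurwitzZetaOdd _).const_mul _).differentiableOn.analyticOnNhd
        hUo) hUc h2U ?_
    filter_upwards [(isOpen_lt continuous_const continuous_re).mem_nhds
      (show (1 : ℝ) < (2 : ℂ).re by simp)] with w hw
    have h := (HurwitzZeta.hasSum_nat_hurwitzZetaOdd_of_mem_Icc ⟨hx.1.le, hx.2.le⟩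
      (s := w) hw).mul_left 2
    rw [← h.tsum_eq]
    refine tsum_congr fun n => ?_
    simp only [hurwitzOddTerm, cpow_neg]
    push_cast
    ring
  have hS : Summable fun n : ℕ => hurwitzOddTerm x n s :=
    hsum.of_norm_bounded fun n => hbound n s hsU
  have h : ∑' n : ℕ, hurwitzOddTerm x n s = 2 * HurwitzZeta.hurwitzZetaOdd x s := heq hsU
  exact h ▸ hS.hasSum

/-- Convexity of `t ↦ t ^ (-σ)` bounds the paired series between two telescoping series: its chord
slope over `[n + x, n + 1 - x]` lies between those over `[n + x, n + 1 + x]` and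
`[n - x, n + 1 - x]`. The upper bound for the term `n = 0` has no such interval to its left in
`(0, ∞)`, so this term is kept as it is. Both bounds tend to `1 - 2 * x` as `σ → 0`. -/
theorem hurwitzZetaOdd_re_bounds {x : ℝ} (hx0 : 0 < x) (hx1 : x ≤ 1 / 2) {σ : ℝ} (hσ : 0 < σ) :
    ∃ r : ℝ, (r : ℂ) = 2 * HurwitzZeta.hurwitzZetaOdd x σ ∧
      (1 - 2 * x) * x ^ (-σ) ≤ r ∧
      r ≤ (x ^ (-σ) - (1 - x) ^ (-σ)) + (1 - 2 * x) * (1 - x) ^ (-σ) := by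
  set φ : ℝ → ℝ := fun t => t ^ (-σ) with hφ
  have hconv : ConvexOn ℝ (Ioi (0 : ℝ)) φ := convexOn_rpow_neg_Ioi hσ.le
  set T : ℕ → ℝ := fun n => φ (n + x) - φ (n + 1 - x) with hT
  have hsC := hasSum_hurwitzOddTerm (x := x) ⟨hx0, by linarith⟩ (s := (σ : ℂ)) (by simpa using hσ)
  have hterm : ∀ n : ℕ, hurwitzOddTerm x n σ = ((T n : ℝ) : ℂ) := fun n => by
    have hn : (0 : ℝ) ≤ n := n.cast_nonneg
    simp only [hurwitzOddTerm, hT, hφ]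
    rw [ofReal_sub ((n + x) ^ (-σ)), ofReal_cpow (by linarith), ofReal_cpow (by linarith), ofReal_neg]
  simp only [hterm] at hsC
  have hS : HasSum T (∑' n, T n) := (summable_ofReal.mp hsC.summable).hasSum
  have hlim := hS.tendsto_sum_nat
  have hφlim : ∀ y : ℝ, Tendsto (fun n : ℕ => φ (n + y)) atTop (𝓝 0) := fun y =>
    (tendsto_rpow_neg_atTop hσ).comp
      (tendsto_atTop_add_const_right _ _ tendsto_natCast_atTop_atTop)
  refine ⟨∑' n, T n, ?_, ?_, ?_⟩
  · rw [ofReal_tsum]; exact hsC.tsum_eq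
  · have hlow : ∀ K : ℕ, (1 - 2 * x) * (φ x - φ (K + x)) ≤ ∑ n ∈ Finset.range K, T n := by
      intro K
      induction K with
      | zero => simp
      | succ K ih =>
        rw [Finset.sum_range_succ]
        have hK : (0 : ℝ) ≤ K := K.cast_nonneg
        have h := hconv.2 (show (K + x : ℝ) ∈ Ioi (0 : ℝ) by simp; linarith)
          (show (K + x + 1 : ℝ) ∈ Ioi (0 : ℝ) by simp; linarith)
          (show 0 ≤ 2 * x by linarith) (show 0 ≤ 1 - 2 * x by linarith) (by ring)
        have e : (2 * x) • (K + x : ℝ) + (1 - 2 * x) • (K + x + 1 : ℝ) = K + 1 - x := by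
          simp only [smul_eq_mul]; ring
        rw [e] at h
        simp only [smul_eq_mul] at h
        have e2 : (((K + 1 : ℕ) : ℝ) + x) = K + x + 1 := by push_cast; ring
        rw [e2]
        simp only [hT]
        linarith
    have := le_of_tendsto_of_tendsto' (((tendsto_const_nhds (x := φ x)).sub
      (hφlim x)).const_mul (1 - 2 * x)) hlim hlow
    simpa using this
  · have hup : ∀ K : ℕ, ∑ n ∈ Finset.range (K + 1), T n ≤
        T 0 + (1 - 2 * x) * (φ (1 - x) - φ (K + (1 - x))) := by
      intro K
      induction K with
      | zero => simp
      | succ K ih =>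
        rw [Finset.sum_range_succ]
        have hK : (0 : ℝ) ≤ K := K.cast_nonneg
        have h := hconv.2 (show (K + (1 - x) : ℝ) ∈ Ioi (0 : ℝ) by simp; linarith)
          (show (K + 1 + (1 - x) : ℝ) ∈ Ioi (0 : ℝ) by simp; linarith)
          (show 0 ≤ 1 - 2 * x by linarith) (show 0 ≤ 2 * x by linarith) (by ring)
        have e : (1 - 2 * x) • (K + (1 - x) : ℝ) + (2 * x) • (K + 1 + (1 - x) : ℝ)
            = K + 1 + x := by
          simp only [smul_eq_mul]; ring
        rw [e] at h
        simp only [smul_eq_mul] at h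
        have e2 : T (K + 1) = φ (K + 1 + x) - φ (K + 1 + (1 - x)) := by
          simp only [hT]; push_cast; ring_nf
        rw [e2]
        push_cast
        linarith
    have := le_of_tendsto_of_tendsto' (hlim.comp (tendsto_add_atTop_nat 1))
      ((((tendsto_const_nhds (x := φ (1 - x))).sub
      (hφlim (1 - x))).const_mul (1 - 2 * x)).const_add (T 0)) hup
    simpa [hT] using this

theorem hurwitzZetaOdd_apply_zero_of_le_half {x : ℝ} (hx0 : 0 < x) (hx1 : x ≤ 1 / 2) :
    HurwitzZeta.hurwitzZetaOdd x 0 = 1 / 2 - x := by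
  have hc : ∀ y : ℝ, 0 < y → Tendsto (fun σ : ℝ => y ^ (-σ)) (𝓝[>] 0) (𝓝 1) := fun y hy => by
    have : Continuous fun σ : ℝ => y ^ (-σ) :=
      continuous_const.rpow continuous_neg fun _ => Or.inl hy.ne'
    simpa using (this.tendsto 0).mono_left nhdsWithin_le_nhds
  have hl : Tendsto (fun σ : ℝ => (2 * HurwitzZeta.hurwitzZetaOdd x σ).re) (𝓝[>] 0)
      (𝓝 (2 * HurwitzZeta.hurwitzZetaOdd x 0).re) := by
    have : Continuous fun σ : ℝ => (2 * HurwitzZeta.hurwitzZetaOdd x σ).re :=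
      continuous_re.comp (continuous_const.mul
        ((HurwitzZeta.differentiable_hurwitzZetaOdd _).continuous.comp continuous_ofReal))
    simpa using (this.tendsto 0).mono_left nhdsWithin_le_nhds
  have hli : Tendsto (fun σ : ℝ => (2 * HurwitzZeta.hurwitzZetaOdd x σ).im) (𝓝[>] 0)
      (𝓝 (2 * HurwitzZeta.hurwitzZetaOdd x 0).im) := by
    have : Continuous fun σ : ℝ => (2 * HurwitzZeta.hurwitzZetaOdd x σ).im :=
      continuous_im.comp (continuous_const.mul
        ((HurwitzZeta.differentiable_hurwitzZetaOdd _).continuous.comp continuous_ofReal))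
    simpa using (this.tendsto 0).mono_left nhdsWithin_le_nhds
  have h1 : Tendsto (fun σ : ℝ => (2 * HurwitzZeta.hurwitzZetaOdd x σ).re) (𝓝[>] 0)
      (𝓝 (1 - 2 * x)) := by
    refine tendsto_of_tendsto_of_tendsto_of_le_of_le'
      (g := fun σ : ℝ => (1 - 2 * x) * x ^ (-σ))
      (h := fun σ : ℝ => (x ^ (-σ) - (1 - x) ^ (-σ)) + (1 - 2 * x) * (1 - x) ^ (-σ)) ?_ ?_ ?_ ?_
    · simpa using (hc x hx0).const_mul (1 - 2 * x)
    · simpa using ((hc x hx0).sub (hc (1 - x) (by linarith))).add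
        ((hc (1 - x) (by linarith)).const_mul (1 - 2 * x))
    · filter_upwards [self_mem_nhdsWithin] with σ hσ
      obtain ⟨r, hr, h, -⟩ := hurwitzZetaOdd_re_bounds hx0 hx1 hσ
      simpa [← hr] using h
    · filter_upwards [self_mem_nhdsWithin] with σ hσ
      obtain ⟨r, hr, -, h⟩ := hurwitzZetaOdd_re_bounds hx0 hx1 hσ
      simpa [← hr] using h
  have h2 : Tendsto (fun σ : ℝ => (2 * HurwitzZeta.hurwitzZetaOdd x σ).im) (𝓝[>] 0) (𝓝 0) := by
    refine tendsto_const_nhds.congr' ?_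
    filter_upwards [self_mem_nhdsWithin] with σ hσ
    obtain ⟨r, hr, -, -⟩ := hurwitzZetaOdd_re_bounds hx0 hx1 hσ
    rw [← hr, ofReal_im]
  have e : 2 * HurwitzZeta.hurwitzZetaOdd x 0 = ((1 - 2 * x : ℝ) : ℂ) := Complex.ext
    (by rw [ofReal_re]; exact tendsto_nhds_unique hl h1)
    (by rw [ofReal_im]; exact tendsto_nhds_unique hli h2)
  have : HurwitzZeta.hurwitzZetaOdd x 0 = (2 * HurwitzZeta.hurwitzZetaOdd x 0) / 2 := by ring
  rw [this, e]
  push_cast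
  ring

/-- The value of the odd Hurwitz zeta function at `0` is the sawtooth function. -/
theorem hurwitzZetaOdd_apply_zero {x : ℝ} (hx : x ∈ Ioo (0 : ℝ) 1) :
    HurwitzZeta.hurwitzZetaOdd x 0 = 1 / 2 - x := by
  rcases le_total x (1 / 2) with h | h
  · exact hurwitzZetaOdd_apply_zero_of_le_half hx.1 h
  · have h1 := hurwitzZetaOdd_apply_zero_of_le_half (x := 1 - x) (by linarith [hx.2])
      (by linarith)
    have e : (((1 - x : ℝ)) : UnitAddCircle) = -(x : UnitAddCircle) := by
      rw [AddCircle.coe_sub, AddCircle.coe_period, zero_sub]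
    rw [e, HurwitzZeta.hurwitzZetaOdd_neg] at h1
    rw [← neg_neg (HurwitzZeta.hurwitzZetaOdd x 0), h1]
    push_cast
    ring

end HurwitzZeta

/-! ### The generalized Bernoulli number of an odd character -/

section Bernoulli

open DirichletCharacter

theorem DirichletCharacter.isPrimitive_of_prime {ℓ : ℕ} [Fact ℓ.Prime]
    {χ : DirichletCharacter ℂ ℓ} (hχ : χ ≠ 1) : χ.IsPrimitive := by
  rcases (Nat.dvd_prime Fact.out).mp χ.conductor_dvd_level with h | h
  · exact absurd (χ.eq_one_iff_conductor_eq_one.mpr h) hχ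
  · exact h

theorem DirichletCharacter.Odd.ne_one {ℓ : ℕ} {χ : DirichletCharacter ℂ ℓ} (hχ : χ.Odd) :
    χ ≠ 1 := by
  rintro rfl
  have h : (1 : DirichletCharacter ℂ ℓ) (-1) = -1 := hχ
  rw [MulChar.one_apply isUnit_one.neg] at h
  norm_num at h

/-- The functional equation carries `L(χ⁻¹, 1) ≠ 0` over to `L(χ, 0) ≠ 0`. -/
theorem DirichletCharacter.Odd.LFunction_apply_zero_ne_zero {ℓ : ℕ} [Fact ℓ.Prime]
    {χ : DirichletCharacter ℂ ℓ} (hχ : χ.Odd) : LFunction χ 0 ≠ 0 := by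
  have hℓ : ℓ ≠ 1 := (Fact.out : ℓ.Prime).ne_one
  have hinv : χ⁻¹ ≠ 1 := inv_ne_one.mpr hχ.ne_one
  intro h0
  have h1 := LFunction_apply_one_ne_zero hinv
  rw [LFunction_eq_completed_div_gammaFactor χ 0 (Or.inr hℓ), hχ.gammaFactor_def,
    div_eq_zero_iff, or_iff_left (Complex.Gammaℝ_ne_zero_of_re_pos (by simp))] at h0
  have hfe := (isPrimitive_of_prime hinv).completedLFunction_one_sub 0
  rw [inv_inv, h0, mul_zero, sub_zero] at hfe
  rw [LFunction_eq_completed_div_gammaFactor _ _ (Or.inr hℓ), hfe, zero_div] at h1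
  exact h1 rfl

theorem DirichletCharacter.Odd.LFunction_apply_zero {ℓ : ℕ} [Fact ℓ.Prime]
    {χ : DirichletCharacter ℂ ℓ} (hχ : χ.Odd) :
    LFunction χ 0 = -(∑ j : ZMod ℓ, χ j * (j.val : ℂ)) / ℓ := by
  have hℓ : (0 : ℝ) < ℓ := Nat.cast_pos.mpr (Fact.out : ℓ.Prime).pos
  have hs : ∑ j : ZMod ℓ, χ j = 0 := MulChar.sum_eq_zero_of_ne_one hχ.ne_one
  have hterm : ∀ j : ZMod ℓ, χ j * HurwitzZeta.hurwitzZetaOdd (ZMod.toAddCircle j) 0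
      = 1 / 2 * χ j - χ j * (j.val : ℂ) / ℓ := by
    intro j
    by_cases hj : j = 0
    · subst hj; simp [MulChar.map_zero]
    · rw [ZMod.toAddCircle_apply, hurwitzZetaOdd_apply_zero]
      · push_cast; ring
      · have : 0 < j.val := Nat.pos_of_ne_zero (by simpa using hj)
        exact ⟨div_pos (by exact_mod_cast this) hℓ,
          (div_lt_one hℓ).mpr (by exact_mod_cast j.val_lt)⟩
  rw [LFunction, ZMod.LFunction_def_odd hχ.to_fun, neg_zero, Complex.cpow_zero, one_mul,
    Finset.sum_congr rfl fun j _ => hterm j, Finset.sum_sub_distrib, ← Finset.mul_sum, hs,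
    mul_zero, zero_sub, ← Finset.sum_div, neg_div]

/-- The generalized Bernoulli number `B_{1,χ}` of an odd character `χ` modulo a prime is
non-zero. -/
theorem DirichletCharacter.Odd.sum_mul_val_ne_zero {ℓ : ℕ} [Fact ℓ.Prime]
    {χ : DirichletCharacter ℂ ℓ} (hχ : χ.Odd) : ∑ j : ZMod ℓ, χ j * (j.val : ℂ) ≠ 0 := by
  intro h
  apply hχ.LFunction_apply_zero_ne_zero
  rw [hχ.LFunction_apply_zero, h, neg_zero, zero_div]

end Bernoulli

/-! ### Singular Demjanenko matrices and odd characters -/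

section Fourier

open Finset

variable {ℓ : ℕ} [Fact ℓ.Prime]

theorem exists_sum_mul_dirichletCharacter_ne_zero {V : (ZMod ℓ)ˣ → ℂ} (hV : V ≠ 0) :
    ∃ χ : DirichletCharacter ℂ ℓ, ∑ a, V a * χ (a : ZMod ℓ) ≠ 0 := by
  by_contra! h
  refine hV (funext fun b => ?_)
  have h1 : ∑ χ : DirichletCharacter ℂ ℓ, χ ((b : ZMod ℓ)⁻¹) * ∑ a, V a * χ (a : ZMod ℓ) = 0 :=
    sum_eq_zero fun χ _ => by rw [h χ, mul_zero]
  simp_rw [mul_sum] at h1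
  rw [sum_comm] at h1
  have h2 : ∀ a : (ZMod ℓ)ˣ, ∑ χ : DirichletCharacter ℂ ℓ,
      χ ((b : ZMod ℓ)⁻¹) * (V a * χ (a : ZMod ℓ)) = if b = a then (ℓ.totient : ℂ) * V b else 0 := by
    intro a
    have := DirichletCharacter.sum_char_inv_mul_char_eq ℂ b.isUnit (a : ZMod ℓ)
    calc _ = V a * ∑ χ : DirichletCharacter ℂ ℓ, χ ((b : ZMod ℓ)⁻¹) * χ (a : ZMod ℓ) := by
          rw [mul_sum]; exact sum_congr rfl fun χ _ => by ring
      _ = _ := by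
          rw [this]
          by_cases hab : b = a
          · subst hab; simp [mul_comm]
          · simp [hab, Units.ext_iff.not.mp hab]
  simp_rw [h2] at h1
  rw [sum_ite_eq, if_pos (mem_univ _)] at h1
  have ht : (ℓ.totient : ℂ) ≠ 0 := by
    exact_mod_cast (Nat.totient_pos.mpr (Fact.out : ℓ.Prime).pos).ne'
  exact (mul_eq_zero.mp h1).resolve_left ht

/-- A non-zero odd function `V`, invariant under a subgroup `H`, whose convolution with `f`
vanishes has a non-zero Fourier coefficient; it belongs to an odd character that is trivial on `H`,
and the corresponding coefficient of `f` has to vanish. -/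
theorem exists_odd_character_of_convolution_eq_zero {f V : (ZMod ℓ)ˣ → ℂ} (hV0 : V ≠ 0)
    (hodd : ∀ a, V (-a) = -V a) {H : Subgroup (ZMod ℓ)ˣ} (hH : ∀ w ∈ H, ∀ a, V (w * a) = V a)
    (hconv : ∀ c, ∑ a, f (c⁻¹ * a) * V a = 0) :
    ∃ χ : DirichletCharacter ℂ ℓ, χ.Odd ∧ (∀ w ∈ H, χ (w : ZMod ℓ) = 1) ∧
      ∑ b : (ZMod ℓ)ˣ, χ (b : ZMod ℓ) * f b = 0 := by
  obtain ⟨χ, hχ⟩ := exists_sum_mul_dirichletCharacter_ne_zero hV0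
  have hχinv : ∀ a : (ZMod ℓ)ˣ, χ⁻¹ (a : ZMod ℓ) = χ ((a⁻¹ : (ZMod ℓ)ˣ) : ZMod ℓ) := fun a => by
    rw [MulChar.inv_apply, Ring.inverse_unit]
  have hodd' : χ (-1) = -1 := by
    have h1 : ∑ a, V a * χ (a : ZMod ℓ) = -χ (-1) * ∑ a, V a * χ (a : ZMod ℓ) := by
      conv_lhs => rw [← Equiv.sum_comp (Equiv.neg (ZMod ℓ)ˣ)]
      rw [mul_sum]
      refine sum_congr rfl fun a _ => ?_
      rw [Equiv.neg_apply, hodd, Units.val_neg, ← neg_one_mul (a : ZMod ℓ), map_mul]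
      ring
    have := mul_right_cancel₀ hχ ((one_mul _).trans h1)
    rw [this, neg_neg]
  have hH' : ∀ w ∈ H, χ (w : ZMod ℓ) = 1 := by
    intro w hw
    have h1 : ∑ a, V a * χ (a : ZMod ℓ) = χ (w : ZMod ℓ) * ∑ a, V a * χ (a : ZMod ℓ) := by
      conv_lhs => rw [← Equiv.sum_comp (Equiv.mulLeft w)]
      rw [mul_sum]
      refine sum_congr rfl fun a _ => ?_
      rw [Equiv.coe_mulLeft, hH w hw, Units.val_mul, map_mul]
      ring
    exact (mul_right_cancel₀ hχ ((one_mul _).trans h1)).symm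
  refine ⟨χ⁻¹, ?_, ?_, ?_⟩
  · have h := hχinv (-1)
    rw [inv_neg_one, Units.val_neg, Units.val_one, hodd'] at h
    exact h
  · intro w hw
    rw [hχinv, hH' _ (H.inv_mem hw)]
  · have h1 : ∑ c : (ZMod ℓ)ˣ, χ (c : ZMod ℓ) * ∑ a, f (c⁻¹ * a) * V a = 0 :=
      sum_eq_zero fun c _ => by rw [hconv, mul_zero]
    simp_rw [mul_sum] at h1
    rw [sum_comm] at h1
    have h2 : ∀ a : (ZMod ℓ)ˣ, ∑ c : (ZMod ℓ)ˣ, χ (c : ZMod ℓ) * (f (c⁻¹ * a) * V a) =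
        V a * χ (a : ZMod ℓ) * ∑ b : (ZMod ℓ)ˣ, χ⁻¹ (b : ZMod ℓ) * f b := by
      intro a
      rw [← Equiv.sum_comp (Equiv.divLeft a), mul_sum]
      refine sum_congr rfl fun b _ => ?_
      rw [Equiv.divLeft_apply, inv_div, div_mul_cancel, hχinv, div_eq_mul_inv, Units.val_mul,
        map_mul]
      ring
    simp_rw [h2, ← sum_mul] at h1
    exact (mul_eq_zero.mp h1).resolve_left hχ

end Fourier

namespace Demjanenko

variable {k ℓ : ℕ} [Fact ℓ.Prime]

theorem natCast_add_one_ne_zero (hkl : k + 2 ≤ ℓ) : (k : ZMod ℓ) + 1 ≠ 0 := by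
  intro h
  have h' : ((k + 1 : ℕ) : ZMod ℓ) = 0 := by exact_mod_cast h
  have := Nat.le_of_dvd (Nat.succ_pos k) ((ZMod.natCast_eq_zero_iff _ _).mp h')
  omega

theorem natCast_ne_zero (hk : 1 ≤ k) (hkl : k + 2 ≤ ℓ) : (k : ZMod ℓ) ≠ 0 := by
  intro h
  have := Nat.le_of_dvd hk ((ZMod.natCast_eq_zero_iff _ _).mp h)
  omega

/-- For the least non-negative representatives, `⟨ka⟩ + ⟨a⟩` and `⟨(k + 1)a⟩` agree up to a carry
of `ℓ`, and `E` records this carry. -/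
theorem mul_E_eq (a : (ZMod ℓ)ˣ) :
    (ℓ : ℚ) * E k ℓ a = ((k : ZMod ℓ) * a).val + (a : ZMod ℓ).val
      - (((k : ZMod ℓ) + 1) * a).val := by
  have h1 := ((k : ZMod ℓ) * a).val_lt
  have h2 := (a : ZMod ℓ).val_lt
  rw [add_mul, one_mul]
  by_cases h : ((k : ZMod ℓ) * a).val + (a : ZMod ℓ).val < ℓ
  · rw [ZMod.val_add_of_lt h, E, if_pos (show a ∈ M k ℓ from h)]
    push_cast
    ring
  · have h3 := ZMod.val_add_val_of_le (not_lt.mp h)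
    rw [E, if_neg (show a ∉ M k ℓ from h)]
    have h4 : (((k : ZMod ℓ) * a).val + (a : ZMod ℓ).val : ℚ) =
      ((k : ZMod ℓ) * a + a).val + ℓ := by exact_mod_cast h3
    linarith

/-- The units are the disjoint union of `M` and `-M`, because `k + 1 ≠ 0` modulo `ℓ` excludes
`⟨ka⟩ + ⟨a⟩ = ℓ`. -/
theorem neg_mem_M_iff (hk : 1 ≤ k) (hkl : k + 2 ≤ ℓ) (a : (ZMod ℓ)ˣ) :
    -a ∈ M k ℓ ↔ a ∉ M k ℓ := by
  have h1 := ((k : ZMod ℓ) * a).val_lt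
  have h2 := (a : ZMod ℓ).val_lt
  have h3 : ((k : ZMod ℓ) * a).val + (a : ZMod ℓ).val ≠ ℓ := by
    intro h
    have h4 : (((((k : ZMod ℓ) * a).val + (a : ZMod ℓ).val : ℕ)) : ZMod ℓ) = 0 := by
      rw [h, ZMod.natCast_self]
    rw [Nat.cast_add, ZMod.natCast_zmod_val, ZMod.natCast_zmod_val, ← add_one_mul] at h4
    exact (mul_ne_zero (natCast_add_one_ne_zero hkl) a.ne_zero) h4
  have h5 : (k : ZMod ℓ) * a ≠ 0 := mul_ne_zero (natCast_ne_zero hk hkl) a.ne_zero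
  simp only [M, Set.mem_ofPred_eq, Units.val_neg, mul_neg, ZMod.neg_val, if_neg h5,
    if_neg a.ne_zero]
  omega

theorem E_neg_sub_half (hk : 1 ≤ k) (hkl : k + 2 ≤ ℓ) (a : (ZMod ℓ)ˣ) :
    E k ℓ (-a) - 1 / 2 = -(E k ℓ a - 1 / 2) := by
  have h := neg_mem_M_iff hk hkl a
  by_cases ha : a ∈ M k ℓ
  · rw [E, E, if_pos ha, if_neg (fun h' => h.mp h' ha)]; norm_num
  · rw [E, E, if_neg ha, if_pos (h.mpr ha)]; norm_num

theorem mk_mem_MmodW_iff (a : (ZMod ℓ)ˣ) :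
    (a : (ZMod ℓ)ˣ ⧸ W k ℓ) ∈ MmodW k ℓ ↔ a ∈ M k ℓ := by
  constructor
  · rintro ⟨b, hb, hab⟩
    have hw : b⁻¹ * a ∈ W k ℓ := QuotientGroup.eq.mp hab
    have h := mul_mem_M_iff b hw
    rw [mul_inv_cancel_left] at h
    exact h.mpr hb
  · exact fun h => ⟨a, h, rfl⟩

theorem sum_comp_quotientMk {G A : Type*} [CommGroup G] [Fintype G] [AddCommMonoid A]
    (H : Subgroup G) [Fintype (G ⧸ H)] (g : G ⧸ H → A) :
    ∑ a : G, g (a : G ⧸ H) = Nat.card H • ∑ x : G ⧸ H, g x := by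
  classical
  rw [← Finset.sum_fiberwise' Finset.univ (fun a : G => (a : G ⧸ H)) g, Finset.smul_sum]
  refine Finset.sum_congr rfl fun x _ => ?_
  rw [Finset.sum_const]
  congr 1
  obtain ⟨b, rfl⟩ := QuotientGroup.mk_surjective x
  rw [Nat.card_eq_fintype_card, ← Fintype.card_coe]
  refine Fintype.card_congr ⟨fun a => ⟨b⁻¹ * a.1, QuotientGroup.eq.mp
      (Finset.mem_filter.mp a.2).2.symm⟩, fun h => ⟨b * h.1, Finset.mem_filter.mpr
      ⟨Finset.mem_univ _, (QuotientGroup.eq.mpr (by simp)).symm⟩⟩, fun a => ?_, fun h => ?_⟩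
  · simp
  · simp

open Classical in
/-- A kernel vector of the Demjanenko matrix extends to an odd, `W`-invariant function on
`(ℤ/ℓℤ)ˣ` whose convolution with `E - 1/2` vanishes. -/
theorem exists_odd_character_of_det_eq_zero (hk : 1 ≤ k) (hkl : k + 2 ≤ ℓ)
    (hdet : (D k ℓ).det = 0) :
    ∃ χ : DirichletCharacter ℂ ℓ, χ.Odd ∧ (∀ w ∈ W k ℓ, χ (w : ZMod ℓ) = 1) ∧
      ∑ b : (ZMod ℓ)ˣ, χ (b : ZMod ℓ) * ((E k ℓ b - 1 / 2 : ℚ) : ℂ) = 0 := by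
  obtain ⟨v, hv0, hv⟩ := Matrix.exists_mulVec_eq_zero_iff.mpr hdet
  let _ : Fintype ((ZMod ℓ)ˣ ⧸ W k ℓ) := Fintype.ofFinite _
  -- `v'` extends `v` by zero, and `V` is the odd part of its pull-back to `(ℤ/ℓℤ)ˣ`, up to a
  -- factor `2`.
  set v' : (ZMod ℓ)ˣ ⧸ W k ℓ → ℚ := fun x => if h : x ∈ MmodW k ℓ then v ⟨x, h⟩ else 0 with hv'
  set V : (ZMod ℓ)ˣ → ℚ := fun a =>
    v' (a : (ZMod ℓ)ˣ ⧸ W k ℓ) - v' ((-a : (ZMod ℓ)ˣ) : (ZMod ℓ)ˣ ⧸ W k ℓ) with hVdef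
  have hVodd : ∀ a, V (-a) = -V a := fun a => by simp only [hVdef, neg_neg, neg_sub]
  have hmk : ∀ w ∈ W k ℓ, ∀ a : (ZMod ℓ)ˣ,
      ((w * a : (ZMod ℓ)ˣ) : (ZMod ℓ)ˣ ⧸ W k ℓ) = (a : (ZMod ℓ)ˣ ⧸ W k ℓ) := fun w hw a =>
    (QuotientGroup.eq.mpr (by rwa [mul_comm w a, inv_mul_cancel_left])).symm
  have hVW : ∀ w ∈ W k ℓ, ∀ a, V (w * a) = V a := fun w hw a => by
    simp only [hVdef, ← mul_neg, hmk w hw]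
  have hV0 : (fun a => (V a : ℂ)) ≠ 0 := by
    obtain ⟨⟨x, a, ha, hax⟩, hx⟩ := Function.ne_iff.mp hv0
    subst hax
    intro h
    have h1 : V a = 0 := Rat.cast_eq_zero.mp (congrFun h a)
    have hna : ((-a : (ZMod ℓ)ˣ) : (ZMod ℓ)ˣ ⧸ W k ℓ) ∉ MmodW k ℓ := by
      rw [mk_mem_MmodW_iff, neg_mem_M_iff hk hkl]
      exact not_not.mpr ha
    simp only [hVdef, hv', dif_pos ((mk_mem_MmodW_iff a).mpr ha), dif_neg hna, sub_zero] at h1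
    exact hx h1
  have hconvM : ∀ c ∈ M k ℓ, ∑ a, (E k ℓ (-(c⁻¹ * a)) - 1 / 2) * V a = 0 := by
    intro c hc
    have h1 : ∑ a : (ZMod ℓ)ˣ, (E k ℓ (-(c⁻¹ * a)) - 1 / 2) *
        v' (a : (ZMod ℓ)ˣ ⧸ W k ℓ) = 0 := by
      have h2 := sum_comp_quotientMk (W k ℓ) fun x : (ZMod ℓ)ˣ ⧸ W k ℓ =>
        (EBar k ℓ (((-1 : (ZMod ℓ)ˣ) : (ZMod ℓ)ˣ ⧸ W k ℓ) *
          ((c : (ZMod ℓ)ˣ ⧸ W k ℓ)⁻¹ * x)) - 1 / 2) * v' x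
      have h3 : ∑ x : (ZMod ℓ)ˣ ⧸ W k ℓ,
          (EBar k ℓ (((-1 : (ZMod ℓ)ˣ) : (ZMod ℓ)ˣ ⧸ W k ℓ) *
          ((c : (ZMod ℓ)ˣ ⧸ W k ℓ)⁻¹ * x)) - 1 / 2) * v' x = 0 := by
        refine Eq.trans ?_ (congrFun hv ⟨(c : (ZMod ℓ)ˣ ⧸ W k ℓ), c, hc, rfl⟩)
        refine (Fintype.sum_of_injective (Subtype.val : MmodW k ℓ → _) Subtype.val_injective _ _
          ?_ ?_).symm
        · intro x hx
          rw [Subtype.range_coe] at hx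
          simp only [hv', dif_neg hx, mul_zero]
        · intro x
          simp only [hv', dif_pos x.2]
          rfl
      rw [h3, smul_zero] at h2
      rw [← h2]
      refine Finset.sum_congr rfl fun a _ => ?_
      rw [← neg_one_mul]
      rfl
    have h4 : ∑ a : (ZMod ℓ)ˣ, (E k ℓ (-(c⁻¹ * a)) - 1 / 2) *
        v' ((-a : (ZMod ℓ)ˣ) : (ZMod ℓ)ˣ ⧸ W k ℓ) = 0 := by
      rw [← Equiv.sum_comp (Equiv.neg (ZMod ℓ)ˣ), ← neg_eq_zero, ← Finset.sum_neg_distrib, ← h1]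
      refine Finset.sum_congr rfl fun a _ => ?_
      rw [Equiv.neg_apply, mul_neg, E_neg_sub_half hk hkl, neg_neg, neg_mul, neg_neg]
    simp only [hVdef, mul_sub, Finset.sum_sub_distrib, h1, h4, sub_zero]
  have hconv : ∀ c, ∑ a, (E k ℓ (c⁻¹ * a) - 1 / 2) * V a = 0 := by
    intro c
    by_cases hc : c ∈ M k ℓ
    · rw [← neg_eq_zero, ← Finset.sum_neg_distrib, ← hconvM c hc]
      refine Finset.sum_congr rfl fun a _ => ?_
      rw [E_neg_sub_half hk hkl, neg_mul]
    · rw [← hconvM (-c) ((neg_mem_M_iff hk hkl c).mpr hc)]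
      refine Finset.sum_congr rfl fun a _ => ?_
      rw [inv_neg, neg_mul, neg_neg]
  refine exists_odd_character_of_convolution_eq_zero (V := fun a => (V a : ℂ))
    (f := fun a => ((E k ℓ a - 1 / 2 : ℚ) : ℂ)) hV0
    (fun a => by rw [hVodd]; push_cast; rfl) (fun w hw a => by rw [hVW w hw]) fun c => ?_
  exact_mod_cast hconv c

end Demjanenko

/-! ### The relation `1 + χ(k)⁻¹ = χ(k + 1)⁻¹` -/

namespace Demjanenko

variable {k ℓ : ℕ} [Fact ℓ.Prime]

theorem sum_units_mul_val (χ : DirichletCharacter ℂ ℓ) (c : (ZMod ℓ)ˣ) :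
    ∑ b : (ZMod ℓ)ˣ, χ (b : ZMod ℓ) * (((c : ZMod ℓ) * b).val : ℂ) =
      χ ((c⁻¹ : (ZMod ℓ)ˣ) : ZMod ℓ) * ∑ j : ZMod ℓ, χ j * (j.val : ℂ) := by
  have h1 : ∑ b : (ZMod ℓ)ˣ, χ (b : ZMod ℓ) * ((b : ZMod ℓ).val : ℂ) =
      ∑ j : ZMod ℓ, χ j * (j.val : ℂ) := by
    refine Fintype.sum_of_injective (Units.val : (ZMod ℓ)ˣ → ZMod ℓ) Units.val_injective _ _ ?_
      fun _ => rfl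
    intro j hj
    rw [χ.map_nonunit fun h => hj ⟨h.unit, rfl⟩, zero_mul]
  rw [← h1, Finset.mul_sum, ← Equiv.sum_comp (Equiv.mulLeft c⁻¹)]
  refine Finset.sum_congr rfl fun b _ => ?_
  rw [Equiv.coe_mulLeft, Units.val_mul, map_mul, Units.mul_inv_cancel_left, mul_assoc]

theorem sum_units_odd {χ : DirichletCharacter ℂ ℓ} (hχ : χ.Odd) :
    ∑ b : (ZMod ℓ)ˣ, χ (b : ZMod ℓ) = 0 := by
  have h : ∑ b : (ZMod ℓ)ˣ, χ (b : ZMod ℓ) = -∑ b : (ZMod ℓ)ˣ, χ (b : ZMod ℓ) := by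
    conv_lhs => rw [← Equiv.sum_comp (Equiv.neg (ZMod ℓ)ˣ)]
    rw [← Finset.sum_neg_distrib]
    exact Finset.sum_congr rfl fun b _ => by rw [Equiv.neg_apply, Units.val_neg, hχ.to_fun]
  exact self_eq_neg.mp h

/-- Substituting the formula for `E` turns the character sum into
`(χ(k)⁻¹ + 1 - χ(k + 1)⁻¹) B_{1,χ}`. -/
theorem one_add_eq_of_sum_eq_zero {χ : DirichletCharacter ℂ ℓ} (hχ : χ.Odd)
    (hsum : ∑ b : (ZMod ℓ)ˣ, χ (b : ZMod ℓ) * ((E k ℓ b - 1 / 2 : ℚ) : ℂ) = 0)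
    {κ κ' : (ZMod ℓ)ˣ} (hκ : (κ : ZMod ℓ) = k) (hκ' : (κ' : ZMod ℓ) = k + 1) :
    1 + χ ((κ⁻¹ : (ZMod ℓ)ˣ) : ZMod ℓ) = χ ((κ'⁻¹ : (ZMod ℓ)ˣ) : ZMod ℓ) := by
  have hterm : ∀ b : (ZMod ℓ)ˣ, (ℓ : ℂ) * (χ (b : ZMod ℓ) * ((E k ℓ b - 1 / 2 : ℚ) : ℂ)) =
      χ (b : ZMod ℓ) * (((κ : ZMod ℓ) * b).val : ℂ)
      + χ (b : ZMod ℓ) * ((((1 : (ZMod ℓ)ˣ) : ZMod ℓ) * b).val : ℂ)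
      - χ (b : ZMod ℓ) * (((κ' : ZMod ℓ) * b).val : ℂ) - (ℓ : ℂ) / 2 * χ (b : ZMod ℓ) := by
    intro b
    have h := congrArg (Rat.cast : ℚ → ℂ) (mul_E_eq (k := k) b)
    push_cast at h
    rw [hκ, hκ', Units.val_one, one_mul]
    push_cast
    linear_combination χ (b : ZMod ℓ) * h
  have h := congrArg ((ℓ : ℂ) * ·) hsum
  simp only [Finset.mul_sum, hterm, mul_zero] at h
  rw [Finset.sum_sub_distrib, Finset.sum_sub_distrib, Finset.sum_add_distrib,
    sum_units_mul_val, sum_units_mul_val, sum_units_mul_val, ← Finset.mul_sum, sum_units_odd hχ,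
    inv_one, Units.val_one, map_one] at h
  have h2 : (1 + χ ((κ⁻¹ : (ZMod ℓ)ˣ) : ZMod ℓ) - χ ((κ'⁻¹ : (ZMod ℓ)ˣ) : ZMod ℓ)) *
      ∑ j : ZMod ℓ, χ j * (j.val : ℂ) = 0 := by linear_combination h
  exact sub_eq_zero.mp ((mul_eq_zero.mp h2).resolve_right hχ.sum_mul_val_ne_zero)

theorem sq_add_self_add_one_eq_zero_of_norm {u : ℂ} (hu : ‖u‖ = 1) (hv : ‖1 + u‖ = 1) :
    u ^ 2 + u + 1 = 0 := by
  have h1 : u * (starRingEnd ℂ) u = 1 := by rw [Complex.mul_conj']; simp [hu]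
  have h2 : (1 + u) * (starRingEnd ℂ) (1 + u) = 1 := by rw [Complex.mul_conj']; simp [hv]
  rw [map_add, map_one] at h2
  linear_combination u * h2 - (u + 1) * h1

theorem eq_one_of_pow_two_pow_eq_one {χ : DirichletCharacter ℂ ℓ} (hχ : χ.Odd) (i : ℕ)
    {y : (ZMod ℓ)ˣ} (hy : y ^ 2 ^ i = 1) (hχy : χ (y : ZMod ℓ) = 1) : y = 1 := by
  induction i with
  | zero => simpa using hy
  | succ i ih =>
    rw [pow_succ, pow_mul] at hy
    have h : ((y ^ 2 ^ i : (ZMod ℓ)ˣ) : ZMod ℓ) ^ 2 = 1 := by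
      rw [← Units.val_pow_eq_pow_val, hy, Units.val_one]
    rcases eq_or_eq_neg_of_sq_eq_sq _ 1 (h.trans (one_pow 2).symm) with h1 | h1
    · exact ih (Units.ext h1)
    · have h2 := congrArg χ h1
      rw [Units.val_pow_eq_pow_val, map_pow, hχy, one_pow, hχ] at h2
      norm_num at h2

/-- An odd character modulo `ℓ = 2 ^ α * N + 1` is injective on the elements of order a power
of `2`, since these include `-1`. -/
theorem pow_eq_one_of_character_pow_eq_one {χ : DirichletCharacter ℂ ℓ} (hχ : χ.Odd) {α N : ℕ}
    (hℓ : ℓ = 2 ^ α * N + 1) {x : (ZMod ℓ)ˣ} (hx : χ (x : ZMod ℓ) ^ N = 1) : x ^ N = 1 := by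
  refine eq_one_of_pow_two_pow_eq_one hχ α ?_ ?_
  · rw [← pow_mul, mul_comm, show 2 ^ α * N = ℓ - 1 by omega, ZMod.units_pow_card_sub_one_eq_one]
  · rw [Units.val_pow_eq_pow_val, map_pow, hx]

/-- If `k` is a primitive cube root of unity modulo `ℓ`, then `M_{k,ℓ}` is the set of `j` with
`⟨j⟩ + ⟨kj⟩ + ⟨k²j⟩ = ℓ`, which multiplication by `k` preserves. -/
theorem mem_W_of_sq_add_self_add_one_eq_zero {κ : (ZMod ℓ)ˣ} (hκ : (κ : ZMod ℓ) = k)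
    (h : (k : ZMod ℓ) ^ 2 + k + 1 = 0) : κ ∈ W k ℓ := by
  have hval : ∀ a : (ZMod ℓ)ˣ, ((-(a : ZMod ℓ)).val : ℚ) = ℓ - (a : ZMod ℓ).val := by
    intro a
    rw [ZMod.neg_val, if_neg a.ne_zero, Nat.cast_sub (a : ZMod ℓ).val_lt.le]
  have hE : ∀ a : (ZMod ℓ)ˣ, E k ℓ (κ * a) = E k ℓ a := by
    intro a
    have h1 := mul_E_eq (k := k) a
    have h2 := mul_E_eq (k := k) (κ * a)
    rw [← hκ] at h h1 h2
    have e1 : ((κ : ZMod ℓ) + 1) * a = -((κ * (κ * a) : (ZMod ℓ)ˣ) : ZMod ℓ) := by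
      push_cast
      linear_combination (a : ZMod ℓ) * h
    have e2 : ((κ : ZMod ℓ) + 1) * ((κ * a : (ZMod ℓ)ˣ) : ZMod ℓ) = -(a : ZMod ℓ) := by
      push_cast
      linear_combination (a : ZMod ℓ) * h
    rw [e1, hval] at h1
    rw [e2, hval] at h2
    rw [← Units.val_mul] at h1 h2
    have hℓ : (ℓ : ℚ) ≠ 0 := Nat.cast_ne_zero.mpr (Fact.out : ℓ.Prime).ne_zero
    refine mul_left_cancel₀ hℓ ?_
    linear_combination h2 - h1
  have hM : ∀ a : (ZMod ℓ)ˣ, κ * a ∈ M k ℓ ↔ a ∈ M k ℓ := by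
    intro a
    have h1 := hE a
    by_cases ha : a ∈ M k ℓ <;> by_cases hb : κ * a ∈ M k ℓ <;> simp [E, ha, hb] at h1 ⊢
  rw [mem_W]
  ext x
  rw [Set.mem_smul_set_iff_inv_smul_mem, smul_eq_mul, ← hM, mul_inv_cancel_left]

open Classical in
/-- If `D_{k,ℓ}` is singular, then `χ(k)⁻¹ = u` and `χ(k + 1)⁻¹ = -u²` for a primitive cube root of
unity `u` and an odd `χ` that is trivial on `W`. The last clause uses the triviality on `W`. -/
theorem pow_eq_of_det_eq_zero (hk : 1 ≤ k) (hkl : k + 2 ≤ ℓ) (hdet : (D k ℓ).det = 0) {α N : ℕ}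
    (hN : Odd N) (hℓ : ℓ = 2 ^ α * N + 1) :
    3 ∣ N ∧ (k : ZMod ℓ) ^ N = 1 ∧ ((k : ZMod ℓ) + 1) ^ N = -1 ∧
      (k : ZMod ℓ) ^ 2 + k + 1 ≠ 0 := by
  obtain ⟨χ, hχ, hχW, hsum⟩ := exists_odd_character_of_det_eq_zero hk hkl hdet
  obtain ⟨κ, hκ⟩ : ∃ κ : (ZMod ℓ)ˣ, (κ : ZMod ℓ) = k :=
    ⟨Units.mk0 _ (natCast_ne_zero hk hkl), rfl⟩
  obtain ⟨κ', hκ'⟩ : ∃ κ' : (ZMod ℓ)ˣ, (κ' : ZMod ℓ) = k + 1 :=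
    ⟨Units.mk0 _ (natCast_add_one_ne_zero hkl), rfl⟩
  have huv := one_add_eq_of_sum_eq_zero hχ hsum hκ hκ'
  set u := χ ((κ⁻¹ : (ZMod ℓ)ˣ) : ZMod ℓ) with hu
  have hu2 : u ^ 2 + u + 1 = 0 := sq_add_self_add_one_eq_zero_of_norm (χ.unit_norm_eq_one _)
    (by rw [huv]; exact χ.unit_norm_eq_one _)
  have hu3 : u ^ 3 = 1 := by linear_combination (u - 1) * hu2
  have hu1 : u ≠ 1 := by
    intro h
    rw [h] at hu2
    norm_num at hu2
  -- `u` has order `3`, which divides `ℓ - 1 = 2 ^ α * N`.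
  have h3 : 3 ∣ N := by
    by_contra h
    have hcop : Nat.Coprime 3 (2 ^ α * N) :=
      Nat.Coprime.mul_right (Nat.Coprime.pow_right _ (by norm_num))
        ((Nat.Prime.coprime_iff_not_dvd Nat.prime_three).mpr h)
    have hpow : u ^ (2 ^ α * N) = 1 := by
      rw [hu, ← map_pow, ← Units.val_pow_eq_pow_val, show 2 ^ α * N = ℓ - 1 by omega,
        ZMod.units_pow_card_sub_one_eq_one, Units.val_one, map_one]
    have := pow_gcd_eq_one.mpr ⟨hu3, hpow⟩
    rw [hcop.gcd_eq_one, pow_one] at this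
    exact hu1 this
  have huN : u ^ N = 1 := by
    obtain ⟨c, rfl⟩ := h3
    rw [pow_mul, hu3, one_pow]
  refine ⟨h3, ?_, ?_, ?_⟩
  · have h := pow_eq_one_of_character_pow_eq_one hχ hℓ (x := κ⁻¹) huN
    rw [inv_pow, inv_eq_one] at h
    rw [← hκ, ← Units.val_pow_eq_pow_val, h, Units.val_one]
  · have hv : χ ((-κ'⁻¹ : (ZMod ℓ)ˣ) : ZMod ℓ) = u ^ 2 := by
      rw [Units.val_neg, hχ.to_fun, ← huv]
      linear_combination -hu2
    have h := pow_eq_one_of_character_pow_eq_one hχ hℓ (x := -κ'⁻¹)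
      (by rw [hv, ← pow_mul, mul_comm, pow_mul, huN, one_pow])
    rw [hN.neg_pow, inv_pow, neg_eq_iff_eq_neg, inv_eq_iff_eq_inv, inv_neg, inv_one] at h
    rw [← hκ', ← Units.val_pow_eq_pow_val, h, Units.val_neg, Units.val_one]
  · intro h
    have := hχW _ ((W k ℓ).inv_mem (mem_W_of_sq_add_self_add_one_eq_zero hκ h))
    exact hu1 this

end Demjanenko

/-! ### A resultant divisible by every exceptional prime -/

section Resultant

open Polynomial

theorem sq_add_self_add_one_dvd_X_pow_sub_one {R : Type*} [CommRing R] {N : ℕ} (h3 : 3 ∣ N) :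
    (X ^ 2 + X + 1 : R[X]) ∣ X ^ N - 1 :=
  (Dvd.intro (X - 1) (by ring) : (X ^ 2 + X + 1 : R[X]) ∣ X ^ 3 - 1).trans
    (by obtain ⟨c, rfl⟩ := h3; exact pow_one_sub_dvd_pow_mul_sub_one X 3 c)

theorem Polynomial.dvd_resultant_of_eval_eq_zero {ℓ : ℕ} {f g : ℤ[X]} {n : ℕ}
    (hg : g.natDegree ≤ n) (hn : n ≠ 0) {x : ZMod ℓ} (hf0 : aeval x f = 0) (hg0 : aeval x g = 0) :
    (ℓ : ℤ) ∣ resultant f g f.natDegree n := by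
  obtain ⟨p, q, -, -, h⟩ := exists_mul_add_mul_eq_C_resultant f g le_rfl hg (Or.inr hn)
  have h1 := congrArg (aeval x) h
  rw [map_add, map_mul, map_mul, hf0, hg0, zero_mul, zero_mul, add_zero, aeval_C] at h1
  exact (ZMod.intCast_zmod_eq_zero_iff_dvd _ _).mp h1.symm

theorem norm_multiset_prod_map_le {ι : Type*} (s : Multiset ι) (f : ι → ℂ) {c : ℝ} (hc : 0 ≤ c)
    (h : ∀ i ∈ s, ‖f i‖ ≤ c) : ‖(s.map f).prod‖ ≤ c ^ Multiset.card s := by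
  induction s using Multiset.induction_on with
  | empty => simp
  | cons a s ih =>
    rw [Multiset.map_cons, Multiset.prod_cons, Multiset.card_cons, pow_succ', norm_mul]
    exact mul_le_mul (h a (Multiset.mem_cons_self a s))
      (ih fun i hi => h i (Multiset.mem_cons_of_mem hi)) (norm_nonneg _) hc

/-- For `3 ∣ N` the polynomials `P = (X ^ N - 1) / (X ^ 2 + X + 1)` and `(X + 1) ^ N + 1` have no
common complex root: `‖ζ‖ = ‖ζ + 1‖ = 1` forces `ζ ^ 2 + ζ + 1 = 0`. So their resultant is a
non-zero integer, and it is divisible by every prime modulo which they have a common root. -/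
theorem exists_int_dvd_of_common_root {N : ℕ} (hN : N ≠ 0) (h3 : 3 ∣ N) :
    ∃ r : ℤ, r ≠ 0 ∧ |r| ≤ 3 ^ (N * N) ∧ ∀ (ℓ : ℕ) (_ : Fact ℓ.Prime) (x : ZMod ℓ),
      x ^ N = 1 → (x + 1) ^ N = -1 → x ^ 2 + x + 1 ≠ 0 → (ℓ : ℤ) ∣ r := by
  obtain ⟨P, hP⟩ := sq_add_self_add_one_dvd_X_pow_sub_one (R := ℤ) h3
  set Q : ℤ[X] := (X + 1) ^ N + 1 with hQ
  have hQdeg : Q.natDegree ≤ N := by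
    rw [hQ]; compute_degree!
  have hΦ : (X ^ 2 + X + 1 : ℤ[X]).Monic := by monicity!
  have hPm : P.Monic := hΦ.of_mul_monic_left (by rw [← hP]; exact monic_X_pow_sub_C 1 hN)
  have hPN : P.natDegree ≤ N := by
    have h := congrArg natDegree hP
    rw [hΦ.natDegree_mul hPm, show (X ^ N - 1 : ℤ[X]) = X ^ N - C 1 by simp,
      natDegree_X_pow_sub_C] at h
    omega
  set φ : ℤ →+* ℂ := Int.castRingHom ℂ
  have hPC : (X ^ N - 1 : ℂ[X]) = (X ^ 2 + X + 1) * P.map φ := by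
    simpa using congrArg (Polynomial.map φ) hP
  have hroot : ∀ ζ ∈ (P.map φ).roots, ζ ^ N = 1 ∧ ζ ^ 2 + ζ + 1 ≠ 0 := by
    intro ζ hζ
    have h0 : (P.map φ).eval ζ = 0 := (mem_roots'.mp hζ).2
    constructor
    · have h := congrArg (eval ζ) hPC
      rw [eval_mul, h0, mul_zero] at h
      simpa [sub_eq_zero] using h
    -- `X ^ N - 1` is separable, so no root of `P` is a root of the other factor.
    · have hsep : ((X ^ 2 + X + 1 : ℂ[X]) * P.map φ).Separable := by
        rw [← hPC]
        simpa using separable_X_pow_sub_C (1 : ℂ) (Nat.cast_ne_zero.mpr hN) one_ne_zero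
      rcases aeval_ne_zero_of_isCoprime hsep.isCoprime ζ with h | h
      · simpa using h
      · exact absurd (by simpa using h0) h
  have hres : ((resultant P Q P.natDegree N : ℤ) : ℂ) =
      ((P.map φ).roots.map (Q.map φ).eval).prod := by
    have h := resultant_eq_prod_eval (P.map φ) (Q.map φ) N (natDegree_map_le.trans hQdeg)
      (IsAlgClosed.splits _)
    rw [(hPm.map φ).leadingCoeff, one_pow, one_mul, hPm.natDegree_map, resultant_map_map] at h
    exact h
  have heval : ∀ ζ : ℂ, (Q.map φ).eval ζ = (ζ + 1) ^ N + 1 := fun ζ => by simp [hQ]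
  refine ⟨resultant P Q P.natDegree N, ?_, ?_, ?_⟩
  · intro h0
    rw [h0, Int.cast_zero] at hres
    obtain ⟨ζ, hζ, h⟩ := Multiset.mem_map.mp (Multiset.prod_eq_zero_iff.mp hres.symm)
    obtain ⟨h1, h2⟩ := hroot ζ hζ
    rw [heval] at h
    have hn1 : ‖ζ‖ = 1 := Complex.norm_eq_one_of_pow_eq_one h1 hN
    have hn2 : ‖1 + ζ‖ = 1 := by
      rw [add_comm]
      refine Complex.norm_eq_one_of_pow_eq_one (n := N * 2) ?_ (by omega)
      rw [pow_mul, eq_neg_of_add_eq_zero_left h]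
      norm_num
    exact h2 (Demjanenko.sq_add_self_add_one_eq_zero_of_norm hn1 hn2)
  · have hbound : ‖((resultant P Q P.natDegree N : ℤ) : ℂ)‖ ≤ ((3 : ℝ) ^ N) ^ N := by
      rw [hres]
      have h3N : (1 : ℝ) ≤ 3 ^ N := one_le_pow₀ (by norm_num)
      refine (norm_multiset_prod_map_le _ _ (by positivity) fun ζ hζ => ?_).trans
        (pow_le_pow_right₀ h3N ((card_roots' _).trans (natDegree_map_le.trans hPN)))
      have hn1 : ‖ζ‖ = 1 := Complex.norm_eq_one_of_pow_eq_one (hroot ζ hζ).1 hN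
      rw [heval]
      have h2 : ‖ζ + 1‖ ≤ 2 := (norm_add_le _ _).trans (by rw [hn1, norm_one]; norm_num)
      have h23 : (2 : ℝ) ^ N + 1 ≤ 3 ^ N := by
        have : 2 ^ N < 3 ^ N := Nat.pow_lt_pow_left (by norm_num) hN
        exact_mod_cast this
      calc ‖(ζ + 1) ^ N + 1‖ ≤ ‖ζ + 1‖ ^ N + 1 := by
            simpa using norm_add_le ((ζ + 1) ^ N) 1
        _ ≤ 2 ^ N + 1 := by gcongr
        _ ≤ 3 ^ N := h23
    rw [Complex.norm_intCast, ← pow_mul] at hbound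
    exact_mod_cast hbound
  · intro ℓ _ x h1 h2 h3
    refine dvd_resultant_of_eval_eq_zero (x := x) hQdeg hN ?_ (by simp [hQ, h2])
    have h := congrArg (aeval x) hP
    rw [map_mul] at h
    simp only [map_sub, map_add, map_pow, aeval_X, map_one, h1, sub_self] at h
    exact (mul_eq_zero.mp h.symm).resolve_left h3

end Resultant

/-! ### Counting the exceptional primes -/

namespace Demjanenko

theorem odd_three_pow_mul {β m : ℕ} (hm : Nat.gcd m 6 = 1) : Odd (3 ^ β * m) := by
  refine (Odd.pow (by decide)).mul ?_
  have h : Nat.Coprime m 2 := Nat.Coprime.coprime_dvd_right (by norm_num) hm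
  exact Nat.coprime_two_right.mp h

theorem L_zero_eq_empty {m : ℕ} (hm : Nat.gcd m 6 = 1) : L 0 m = ∅ := by
  rw [Set.eq_empty_iff_forall_notMem]
  rintro ℓ ⟨_, ⟨α, -, hℓ⟩, k, hk, hkl, hdet⟩
  have h3 := (pow_eq_of_det_eq_zero hk hkl hdet (odd_three_pow_mul (β := 0) hm)
    (hℓ.trans (by ring) : ℓ = 2 ^ α * (3 ^ 0 * m) + 1)).1
  rw [pow_zero, one_mul] at h3
  have : 3 ∣ Nat.gcd m 6 := Nat.dvd_gcd h3 (by norm_num)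
  rw [hm] at this
  norm_num at this

/-- The primes of `L β m` exceed `3 ^ β`, and their product divides an integer of absolute value at
most `3 ^ (3 ^ β * m) ^ 2`. -/
theorem L_finite_and_mul_ncard_le {β m : ℕ} (hβ : 1 ≤ β) (hm1 : 1 ≤ m) (hm : Nat.gcd m 6 = 1) :
    (L β m).Finite ∧ β * (L β m).ncard ≤ (3 ^ β * m) * (3 ^ β * m) := by
  set N := 3 ^ β * m with hN
  have hN0 : N ≠ 0 := by positivity
  obtain ⟨r, hr0, hr, hdvd⟩ := exists_int_dvd_of_common_root hN0
    ((dvd_pow_self 3 (by omega)).mul_right m)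
  have hL : ∀ ℓ ∈ L β m, ℓ.Prime ∧ ℓ ∣ r.natAbs ∧ 3 ^ β ≤ ℓ := by
    rintro ℓ ⟨hp, ⟨α, -, hℓ⟩, k, hk, hkl, hdet⟩
    rw [mul_assoc, ← hN] at hℓ
    obtain ⟨-, h1, h2, h3⟩ := pow_eq_of_det_eq_zero hk hkl hdet (odd_three_pow_mul hm) hℓ
    refine ⟨hp.out, Int.natCast_dvd.mp (hdvd ℓ hp k h1 h2 h3), ?_⟩
    have h4 : 3 ^ β ≤ N := Nat.le_mul_of_pos_right _ hm1
    have h5 : N ≤ 2 ^ α * N := Nat.le_mul_of_pos_left _ (by positivity)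
    omega
  have hr0' : r.natAbs ≠ 0 := Int.natAbs_ne_zero.mpr hr0
  have hfin : (L β m).Finite := (Nat.primeFactors r.natAbs).finite_toSet.subset fun ℓ hℓ =>
    Nat.mem_primeFactors.mpr ⟨(hL ℓ hℓ).1, (hL ℓ hℓ).2.1, hr0'⟩
  refine ⟨hfin, ?_⟩
  rw [Set.ncard_eq_toFinset_card _ hfin]
  have hprod : ∏ ℓ ∈ hfin.toFinset, ℓ ∣ r.natAbs := Finset.prod_primes_dvd _
    (fun ℓ hℓ => ((hL ℓ (hfin.mem_toFinset.mp hℓ)).1).prime)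
    fun ℓ hℓ => (hL ℓ (hfin.mem_toFinset.mp hℓ)).2.1
  have hle : (3 ^ β) ^ hfin.toFinset.card ≤ 3 ^ (N * N) := by
    calc (3 ^ β) ^ hfin.toFinset.card ≤ ∏ ℓ ∈ hfin.toFinset, ℓ :=
          Finset.pow_card_le_prod _ _ _ fun ℓ hℓ => (hL ℓ (hfin.mem_toFinset.mp hℓ)).2.2
      _ ≤ r.natAbs := Nat.le_of_dvd (Nat.pos_of_ne_zero hr0') hprod
      _ ≤ 3 ^ (N * N) := by zify; exact_mod_cast hr
  rw [← pow_mul] at hle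
  exact (Nat.pow_le_pow_iff_right (by norm_num)).mp hle

end Demjanenko

theorem theorem5 :
    (∀ β m : ℕ, 1 ≤ m → Nat.gcd m 6 = 1 → (Demjanenko.L β m).Finite) ∧
    (∀ m : ℕ, 1 ≤ m → Nat.gcd m 6 = 1 → Demjanenko.L 0 m = ∅) ∧
    (∃ C : ℝ, ∀ β m : ℕ, 1 ≤ β → 1 ≤ m → Nat.gcd m 6 = 1 →
      ((Demjanenko.L β m).ncard : ℝ) ≤ C * ((3 : ℝ) ^ (2 * β) * (m : ℝ) ^ 2 / (β : ℝ))) := by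
  refine ⟨fun β m hm1 hm => ?_, fun m _ hm => Demjanenko.L_zero_eq_empty hm, 1,
    fun β m hβ hm1 hm => ?_⟩
  · rcases Nat.eq_zero_or_pos β with rfl | hβ
    · rw [Demjanenko.L_zero_eq_empty hm]
      exact Set.finite_empty
    · exact (Demjanenko.L_finite_and_mul_ncard_le hβ hm1 hm).1
  · have h := (Demjanenko.L_finite_and_mul_ncard_le hβ hm1 hm).2
    have h' : (β : ℝ) * (Demjanenko.L β m).ncard ≤ (3 ^ β * m) * (3 ^ β * m) := by
      exact_mod_cast h
    have hβ0 : (0 : ℝ) < β := by exact_mod_cast hβ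
    rw [one_mul, le_div_iff₀ hβ0]
    calc ((Demjanenko.L β m).ncard : ℝ) * β = β * (Demjanenko.L β m).ncard := mul_comm _ _
      _ ≤ (3 ^ β * m) * (3 ^ β * m) := h'
      _ = 3 ^ (2 * β) * (m : ℝ) ^ 2 := by ring
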